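/- Let $r$ and $m$ be positive integers with $r<m$, and assume that $r\le m-2$ or $(r,m)=(1,2)$. Let $n=2^m$ and let $\alpha_1,\dots,\alpha_n$ be an ordered list of all vectors of $\mathbb F_2^m$. Let $\mathrm{RM}(r,m)\subseteq\mathbb F_2^n$ be the binary Reed–Muller code, consisting of all words $(f(\alpha_1),\dots,f(\alpha_n))$, where $f$ ranges over the polynomials in $\mathbb F_2[X_1,\dots,X_m]$ of total degree at most $r$. Let $\mathrm{Aut}(\mathrm{RM}(r,m))\le S_n$ be its automorphism group, i.e. the group of all permutations of the $n$ coordinates that map the code onto itself (equivalently, for a generator matrix $M$ of the code, the permutations with permutation matrix $P$ such that $M=SMP$ for some invertible matrix $S$ over $\mathbb F_2$). Then the minimal degree of $\mathrm{Aut}(\mathrm{RM}(r,m))$, that is, the least number of points moved by a non-identity element of this group, is exactly $2^{m-1}=n/2$. -/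

import Mathlib

/-- The permutation automorphism group of a linear code `C ⊆ F^ι`: the permutations of the
coordinates that carry `C` onto itself. -/
def codeAut {F ι : Type*} [Field F] (C : Submodule F (ι → F)) : Subgroup (Equiv.Perm ι) where
  carrier := {σ | ∀ c : ι → F, (fun i => c (σ i)) ∈ C ↔ c ∈ C}
  one_mem' := fun _ => Iff.rfl
  mul_mem' := by
    intro σ τ hσ hτ c
    exact (hτ (fun i => c (σ i))).trans (hσ c)
  inv_mem' := by
    intro σ hσ c
    have h := hσ (fun i => c (σ⁻¹ i))
    simpa using h.symm

/-- `M` is a generator matrix of the linear code `C`: its rows form a basis of `C`. -/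
def IsGeneratorMatrix {F ι : Type*} [Field F] {k : ℕ} (M : Matrix (Fin k) ι F)
    (C : Submodule F (ι → F)) : Prop :=
  LinearIndependent F M.row ∧ Submodule.span F (Set.range M.row) = C

/-- Description of `codeAut` by a generator matrix `M` of the code: a permutation with
permutation matrix `P` is an automorphism if and only if `M = S M P` for an invertible
`k × k` matrix `S`. -/
theorem mem_codeAut_iff_generatorMatrix {F ι : Type*} [Field F] [Fintype ι] [DecidableEq ι]
    {k : ℕ} (M : Matrix (Fin k) ι F) (C : Submodule F (ι → F)) (hM : IsGeneratorMatrix M C)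
    (σ : Equiv.Perm ι) :
    σ ∈ codeAut C ↔
      ∃ S : GL (Fin k) F, M = (S : Matrix (Fin k) (Fin k) F) * M * σ.permMatrix F := by
  obtain ⟨hli, hspan⟩ := hM
  have hmem : ∀ a, M a ∈ C := fun a => hspan ▸ Submodule.subset_span ⟨a, rfl⟩
  have hcomb : ∀ N : Matrix (Fin k) ι F, (∀ a, N a ∈ C) →
      ∃ T : Matrix (Fin k) (Fin k) F, N = T * M := by
    intro N hN
    have h : ∀ a, ∃ t : Fin k → F, ∑ b, t b • M b = N a := fun a => by
      have := hN a
      rw [← hspan] at this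
      exact (Submodule.mem_span_range_iff_exists_fun F).1 this
    choose T hT using h
    refine ⟨Matrix.of T, ?_⟩
    ext a i
    rw [← hT a]
    simp [Matrix.mul_apply, Finset.sum_apply]
  have hcancel : ∀ T : Matrix (Fin k) (Fin k) F, T * M = M → T = 1 := by
    intro T hT
    have hinj := Matrix.vecMul_injective_iff.2 hli
    ext a b
    have : Matrix.vecMul (T a) M = Matrix.vecMul ((1 : Matrix (Fin k) (Fin k) F) a) M := by
      have e : ∀ X : Matrix (Fin k) (Fin k) F, Matrix.vecMul (X a) M = (X * M) a := fun X => by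
        ext i; rfl
      rw [e, e, hT, Matrix.one_mul]
    exact congrFun (hinj this) b
  have hP : ∀ (N : Matrix (Fin k) ι F) (τ : Equiv.Perm ι) (a : Fin k) (i : ι),
      (N * τ.permMatrix F) a i = N a (τ⁻¹ i) := by
    intro N τ a i
    simp [Matrix.mul_apply, Equiv.Perm.permMatrix, PEquiv.toMatrix_apply,
      ← Equiv.Perm.eq_inv_iff_eq]
  have hPP : σ.permMatrix F * (σ⁻¹).permMatrix F = 1 := by
    simp [← Matrix.permMatrix_mul]
  have hPP' : (σ⁻¹).permMatrix F * σ.permMatrix F = 1 := by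
    simp [← Matrix.permMatrix_mul]
  constructor
  · intro hσ
    have hσ' := (codeAut C).inv_mem hσ
    obtain ⟨T, hT⟩ := hcomb (M * σ.permMatrix F) fun a => by
      have : (M * σ.permMatrix F) a = fun i => M a (σ⁻¹ i) := funext (hP M σ a)
      rw [this]; exact (hσ' (M a)).2 (hmem a)
    obtain ⟨S, hS⟩ := hcomb (M * (σ⁻¹).permMatrix F) fun a => by
      have : (M * (σ⁻¹).permMatrix F) a = fun i => M a (σ i) := by
        funext i; rw [hP]; simp
      rw [this]; exact (hσ (M a)).2 (hmem a)
    have key : S * M * σ.permMatrix F = M := by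
      rw [← hS, Matrix.mul_assoc, hPP', Matrix.mul_one]
    have hST : S * T = 1 := hcancel _ (by rw [Matrix.mul_assoc, ← hT, ← Matrix.mul_assoc, key])
    exact ⟨⟨S, T, hST, mul_eq_one_comm.1 hST⟩, key.symm⟩
  · rintro ⟨S, hS⟩
    have row_mem : ∀ (T : Matrix (Fin k) (Fin k) F) (a : Fin k), (T * M) a ∈ C := by
      intro T a
      have : (T * M) a = ∑ b, T a b • M b := by
        ext i; simp [Matrix.mul_apply, Finset.sum_apply]
      rw [this]
      exact C.sum_mem fun b _ => C.smul_mem _ (hmem b)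
    have hext : ∀ τ : Equiv.Perm ι, (∀ a, (fun i => M a (τ i)) ∈ C) →
        ∀ c ∈ C, (fun i => c (τ i)) ∈ C := by
      intro τ h c hc
      have hle : C ≤ C.comap (LinearMap.funLeft F F τ) := by
        conv_lhs => rw [← hspan]
        rw [Submodule.span_le]
        rintro _ ⟨a, rfl⟩
        exact h a
      exact hle hc
    have h1 : ∀ c ∈ C, (fun i => c (σ i)) ∈ C := hext σ fun a => by
      have e : M * (σ⁻¹).permMatrix F = (S : Matrix (Fin k) (Fin k) F) * M := by
        conv_lhs => rw [hS]
        rw [Matrix.mul_assoc, hPP, Matrix.mul_one]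
      have : (fun i => M a (σ i)) = ((S : Matrix (Fin k) (Fin k) F) * M) a := by
        rw [← e]; funext i; rw [hP]; simp
      rw [this]; exact row_mem _ a
    have h2 : ∀ c ∈ C, (fun i => c (σ⁻¹ i)) ∈ C := hext σ⁻¹ fun a => by
      have e : M * σ.permMatrix F = ((S⁻¹ : GL (Fin k) F) : Matrix (Fin k) (Fin k) F) * M := by
        conv_rhs => rw [hS]
        rw [← Matrix.mul_assoc, ← Matrix.mul_assoc, Units.inv_mul, Matrix.one_mul]
      have : (fun i => M a (σ⁻¹ i)) =
          (((S⁻¹ : GL (Fin k) F) : Matrix (Fin k) (Fin k) F) * M) a := by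
        rw [← e]; funext i; rw [hP]
      rw [this]; exact row_mem _ a
    intro c
    refine ⟨fun h => ?_, h1 c⟩
    have := h2 _ h
    simpa using this

/-- The binary Reed-Muller code of order `r` and length `2 ^ m`, with respect to an ordered list
`α` of all binary vectors of length `m`: the words `(f (α₁), …, f (αₙ))`, where `f` ranges over
the polynomials over `𝔽₂` in `m` variables of total degree at most `r`. -/
noncomputable def reedMuller (r m : ℕ) (α : Fin (2 ^ m) ≃ (Fin m → ZMod 2)) :
    Submodule (ZMod 2) (Fin (2 ^ m) → ZMod 2) where
  carrier := {c | ∃ f : MvPolynomial (Fin m) (ZMod 2),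
    f.totalDegree ≤ r ∧ c = fun i => MvPolynomial.eval (α i) f}
  zero_mem' := ⟨0, by simp, by ext i; simp⟩
  add_mem' := by
    rintro _ _ ⟨f, hf, rfl⟩ ⟨g, hg, rfl⟩
    exact ⟨f + g, (MvPolynomial.totalDegree_add f g).trans (max_le hf hg), by ext i; simp⟩
  smul_mem' := by
    rintro a _ ⟨f, hf, rfl⟩
    exact ⟨a • f, (MvPolynomial.totalDegree_smul_le a f).trans hf, by
      ext i; simp [MvPolynomial.smul_eval]⟩

/-- `d` is the minimal degree of the permutation group `H`: the smallest number of points moved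
by a non-identity element of `H`. -/
def IsMinimalDegree {ι : Type*} [Fintype ι] [DecidableEq ι] (H : Subgroup (Equiv.Perm ι))
    (d : ℕ) : Prop :=
  IsLeast {s : ℕ | ∃ σ ∈ H, σ ≠ 1 ∧ σ.support.card = s} d

/-!
Let `σ ≠ 1` be an automorphism moving fewer than `2 ^ (m - 1)` points, and let `σ p ≠ p`. If `A` is
an affine flat of codimension at most `r`, its indicator is a codeword `c`, and the codeword
`c ∘ σ - c` is supported on moved points lying in `A` or sent into `A`; its weight is at most twice
the number of moved points in `A`. As soon as this is less than the minimum distance `2 ^ (m - r)`,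
`A` is `σ`-invariant, which is absurd if `A` contains `p` but not `σ p`.

Such an `A` is found by cutting with `r` hyperplanes through `p`. Among the hyperplanes through `p`
that avoid a given moved point `q`, every point off the line `pq` lies on exactly half, so one of
them contains at most half of the moved points. Take `q = σ p` first, and afterwards any other moved
point that remains. Either the count is halved `r` times, or only `p` remains, in which case
`r + 2 ≤ m` suffices. The bound is attained by a transvection, which fixes exactly a hyperplane.

The minimum distance comes from differencing: `f (x + a) - f x` has smaller degree than `f` and at
most twice its weight.
-/

section Polynomials

open MvPolynomial

theorem eval_bind₁ {σ τ R : Type*} [CommSemiring R] (x : τ → R) (g : σ → MvPolynomial τ R)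
    (f : MvPolynomial σ R) : eval x (bind₁ g f) = eval (fun i => eval x (g i)) f := by
  simp only [← coe_aeval_eq_eval, RingHom.coe_coe, aeval_bind₁]

theorem totalDegree_bind₁_le {σ τ R : Type*} [CommSemiring R] {g : σ → MvPolynomial τ R}
    (hg : ∀ i, (g i).totalDegree ≤ 1) (f : MvPolynomial σ R) :
    (bind₁ g f).totalDegree ≤ f.totalDegree := by
  rw [bind₁, aeval_def, eval₂_eq]
  refine totalDegree_finsetSum_le fun s hs => (totalDegree_mul _ _).trans ?_
  calc (algebraMap R (MvPolynomial τ R) (f.coeff s)).totalDegree +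
        (∏ i ∈ s.support, g i ^ s i).totalDegree
      ≤ 0 + ∑ i ∈ s.support, s i := by
        refine add_le_add (totalDegree_C _).le ((totalDegree_finsetProd _ _).trans ?_)
        refine Finset.sum_le_sum fun i _ => (totalDegree_pow _ _).trans ?_
        exact mul_le_of_le_one_right' (hg i)
    _ ≤ f.totalDegree := (zero_add _).trans_le (le_totalDegree hs)

theorem totalDegree_X_add_C_le {σ R : Type*} [CommSemiring R] (i : σ) (b : R) :
    (X i + C b).totalDegree ≤ 1 := by
  refine (totalDegree_add _ _).trans (max_le ?_ ((totalDegree_C b).trans_le zero_le_one))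
  exact (totalDegree_monomial_le _ _).trans_eq (Finsupp.sum_single_index rfl)

theorem exists_eq_add_single_one_of_degree_eq_succ {σ : Type*} {s : σ →₀ ℕ} {n : ℕ}
    (hs : s.degree = n + 1) : ∃ t i, t.degree = n ∧ s = t + Finsupp.single i 1 := by
  obtain ⟨t, hts, ht⟩ := s.exists_le_degree_eq n (by lia)
  obtain ⟨u, rfl⟩ := le_iff_exists_add.mp hts
  obtain ⟨i, rfl⟩ := (Finsupp.sum_eq_one_iff u).1 (show u.degree = 1 by simp_all)
  exact ⟨t, i, ht, rfl⟩

variable {σ R : Type*} [CommRing R]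

theorem totalDegree_bind₁_X_add_C_monomial_sub_le (a : σ → R) (c : R) (s : σ →₀ ℕ) :
    (bind₁ (fun i => X i + C (a i)) (monomial s c) - monomial s c).totalDegree ≤ s.degree - 1 := by
  induction hn : s.degree generalizing s with
  | zero => simp [(Finsupp.degree_eq_zero_iff s).1 hn]
  | succ n ih =>
    obtain ⟨t, i, rfl, rfl⟩ := exists_eq_add_single_one_of_degree_eq_succ hn
    have leibniz : bind₁ (fun i => X i + C (a i)) (monomial (t + Finsupp.single i 1) c)
          - monomial (t + Finsupp.single i 1) c
        = (bind₁ (fun i => X i + C (a i)) (monomial t c) - monomial t c) * (X i + C (a i))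
          + monomial t c * C (a i) := by
      rw [monomial_add_single, pow_one, map_mul, bind₁_X_right]
      ring
    rw [leibniz, Nat.add_sub_cancel]
    refine (totalDegree_add _ _).trans (max_le ?_ ?_)
    · obtain rfl | ht := eq_or_ne t 0
      · simp
      have one_le_degree : 1 ≤ t.degree :=
        Nat.one_le_iff_ne_zero.2 ((Finsupp.degree_eq_zero_iff t).not.2 ht)
      calc _ ≤ _ := totalDegree_mul _ _
        _ ≤ (t.degree - 1) + 1 := add_le_add (ih t rfl) (totalDegree_X_add_C_le i (a i))
        _ = t.degree := Nat.sub_add_cancel one_le_degree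
    · refine (totalDegree_mul _ _).trans ?_
      rw [totalDegree_C]
      exact totalDegree_monomial_le t c

theorem totalDegree_bind₁_X_add_C_sub_le (a : σ → R) (f : MvPolynomial σ R) :
    (bind₁ (fun i => X i + C (a i)) f - f).totalDegree ≤ f.totalDegree - 1 := by
  have sum_monomials : bind₁ (fun i => X i + C (a i)) f - f = ∑ s ∈ f.support,
      (bind₁ (fun i => X i + C (a i)) (monomial s (f.coeff s)) - monomial s (f.coeff s)) := by
    rw [Finset.sum_sub_distrib, ← map_sum, ← f.as_sum]
  rw [sum_monomials]
  exact totalDegree_finsetSum_le fun s hs =>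
    (totalDegree_bind₁_X_add_C_monomial_sub_le a _ s).trans
      (Nat.sub_le_sub_right (le_totalDegree hs) 1)

end Polynomials

section HammingNorm

variable {ι R : Type*} [Fintype ι] [Zero R] [DecidableEq R]

theorem hammingNorm_const {b : R} (hb : b ≠ 0) : hammingNorm (fun _ : ι => b) = Fintype.card ι := by
  simp [hammingNorm, hb, Finset.card_univ]

theorem hammingDist_comp_perm_le [DecidableEq ι] (σ : Equiv.Perm ι) (c : ι → R) :
    hammingDist (c ∘ σ) c ≤ 2 * (σ.support.filter fun i => c i ≠ 0).card := by
  -- `c ∘ σ` and `c` can differ only on the moved points of the support of `c` and their preimages.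
  rw [two_mul]
  nth_rw 1 [← Finset.card_map σ.symm.toEmbedding]
  refine (Finset.card_le_card fun i hi => ?_).trans (Finset.card_union_le _ _)
  have hi : c (σ i) ≠ c i := by simpa using hi
  have hσi : σ i ≠ i := fun h => hi (congrArg c h)
  by_cases hci : c i = 0 <;> simp_all

end HammingNorm

open MvPolynomial in
theorem card_le_two_pow_mul_hammingNorm_eval {σ R : Type*} [CommRing R] [DecidableEq R]
    [Fintype (σ → R)] {d : ℕ} {f : MvPolynomial σ R} (hf : f.totalDegree ≤ d)
    (hne : ∃ x, eval x f ≠ 0) :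
    Fintype.card (σ → R) ≤ 2 ^ d * hammingNorm (fun x => eval x f) := by
  classical
  induction d generalizing f with
  | zero =>
    obtain ⟨b, rfl⟩ : ∃ b, f = C b := ⟨_, totalDegree_eq_zero_iff_eq_C.1 (Nat.le_zero.1 hf)⟩
    simp only [eval_C, exists_const_iff] at hne ⊢
    rw [hammingNorm_const hne.2, pow_zero, one_mul]
  | succ d ih =>
    obtain ⟨x₀, hx₀⟩ := hne
    by_cases hconst : ∀ x, eval x f = eval x₀ f
    · simp only [hconst, hammingNorm_const hx₀]
      exact Nat.le_mul_of_pos_left _ (by positivity)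
    push Not at hconst
    obtain ⟨x, hx⟩ := hconst
    set Δf := bind₁ (fun i => X i + C ((x - x₀) i)) f - f with hΔf
    have eval_Δf (y : σ → R) : eval y Δf = eval (y + (x - x₀)) f - eval y f := by
      simp [hΔf, eval_bind₁, Pi.add_def]
    have norm_Δf : hammingNorm (fun y => eval y Δf) ≤ 2 * hammingNorm (fun y => eval y f) :=
      calc hammingNorm (fun y => eval y Δf)
          = hammingDist ((fun y => eval y f) ∘ Equiv.addRight (x - x₀)) (fun y => eval y f) := by
            rw [hammingDist_comm, hammingDist_eq_hammingNorm, neg_add_eq_sub]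
            simp only [eval_Δf]
            rfl
        _ ≤ 2 * _ := hammingDist_comp_perm_le _ _
        _ ≤ 2 * hammingNorm (fun y => eval y f) :=
            Nat.mul_le_mul_left 2 (Finset.card_le_card
              (Finset.filter_subset_filter _ (Finset.subset_univ _)))
    calc Fintype.card (σ → R)
        ≤ 2 ^ d * hammingNorm (fun y => eval y Δf) :=
          ih ((totalDegree_bind₁_X_add_C_sub_le _ f).trans (Nat.sub_le_of_le_add hf))
            ⟨x₀, by simpa [eval_Δf, sub_eq_zero] using hx⟩
      _ ≤ 2 ^ d * (2 * hammingNorm (fun y => eval y f)) := Nat.mul_le_mul_left _ norm_Δf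
      _ = 2 ^ (d + 1) * hammingNorm (fun y => eval y f) := by rw [pow_succ, mul_assoc]

section LinearForms

open Module

variable {K V : Type*} [Field K] [AddCommGroup V] [Module K V]

theorem card_mul_card_filter_apply_eq_zero [Fintype K] [DecidableEq K] (φ : Dual K V) {w : V}
    (hw : φ w = 1) {s : Finset V} (hs : ∀ x ∈ s, ∀ c : K, x + c • w ∈ s) :
    Fintype.card K * (s.filter fun x => φ x = 0).card = s.card := by
  have fiber_card (c : K) :
      (s.filter fun x => φ x = c).card = (s.filter fun x => φ x = 0).card := by
    refine Finset.card_equiv (Equiv.addRight (-c • w)) fun x => ?_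
    have hmem : x + -c • w ∈ s ↔ x ∈ s :=
      ⟨fun h => by simpa using hs _ h c, fun h => hs x h (-c)⟩
    simp [-neg_smul, hmem, hw, add_neg_eq_zero]
  have sum_fibers :=
    Finset.card_eq_sum_card_fiberwise (s := s) (t := Finset.univ) (f := φ) (by simp)
  simpa only [fiber_card, Finset.sum_const, Finset.card_univ, smul_eq_mul] using sum_fibers.symm

theorem exists_dual_eq_zero_eq_one {v t : V} (ht : t ∉ Submodule.span K {v}) :
    ∃ φ : Dual K V, φ v = 0 ∧ φ t = 1 := by
  obtain ⟨φ, hφt, hφ⟩ := Submodule.exists_le_ker_of_notMem ht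
  have hφv : φ v = 0 := hφ (Submodule.mem_span_singleton_self v)
  exact ⟨(φ t)⁻¹ • φ, by simp [hφv], by simp [hφt]⟩

theorem exists_dual_eq_one_card_mul_card_filter_le [Fintype K] [DecidableEq K] [Finite V] {v : V}
    (hv : v ≠ 0) {T : Finset V} (hT : ∀ t ∈ T, t ∉ Submodule.span K {v}) :
    ∃ φ : Dual K V, φ v = 1 ∧ Fintype.card K * (T.filter fun t => φ t = 0).card ≤ T.card := by
  classical
  have : Finite (Dual K V) := DFunLike.finite _
  have := Fintype.ofFinite (Dual K V)
  set Φ : Finset (Dual K V) := {φ | φ v = 1} with hΦ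
  have hΦne : Φ.Nonempty := by
    obtain ⟨φ, hφ⟩ := Module.Projective.exists_dual_eq_one K hv
    exact ⟨φ, by simpa [hΦ] using hφ⟩
  have vanishing_at (t : V) (ht : t ∈ T) :
      Fintype.card K * (Φ.filter fun φ => φ t = 0).card = Φ.card := by
    obtain ⟨ψ, hψv, hψt⟩ := exists_dual_eq_zero_eq_one (hT t ht)
    exact card_mul_card_filter_apply_eq_zero (Dual.eval K V t) hψt fun φ hφ c => by simp_all
  have double_count : ∑ φ ∈ Φ, (Fintype.card K * (T.filter fun t => φ t = 0).card) =
      ∑ _φ ∈ Φ, T.card :=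
    calc ∑ φ ∈ Φ, (Fintype.card K * (T.filter fun t => φ t = 0).card)
        = Fintype.card K * ∑ t ∈ T, (Φ.filter fun φ => φ t = 0).card := by
          rw [← Finset.mul_sum]
          exact congrArg _ (Finset.sum_card_bipartiteAbove_eq_sum_card_bipartiteBelow _)
      _ = ∑ _t ∈ T, Φ.card := by rw [Finset.mul_sum, Finset.sum_congr rfl vanishing_at]
      _ = ∑ _φ ∈ Φ, T.card := by simp only [Finset.sum_const, smul_eq_mul, mul_comm]
  obtain ⟨φ, hφ, hle⟩ := Finset.exists_le_of_sum_le hΦne double_count.le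
  exact ⟨φ, by simpa [hΦ] using hφ, hle⟩

end LinearForms

section BinaryFlats

open Module

variable {V : Type*} [AddCommGroup V] [Module (ZMod 2) V] [Finite V] {v : V} {T : Finset V}

theorem exists_dual_eq_one_two_mul_card_filter_le (h0 : 0 ∈ T) (hv : v ∈ T) (hv0 : v ≠ 0) :
    ∃ φ : Dual (ZMod 2) V, φ v = 1 ∧ 2 * (T.filter fun t => φ t = 0).card ≤ T.card := by
  classical
  have notMem_span : ∀ t ∈ (T.erase v).erase 0, t ∉ Submodule.span (ZMod 2) {v} := by
    intro t ht hspan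
    obtain ⟨c, rfl⟩ := Submodule.mem_span_singleton.1 hspan
    obtain rfl | rfl := (by decide : ∀ c : ZMod 2, c = 0 ∨ c = 1) c <;> simp at ht
  obtain ⟨φ, hφv, hφ⟩ := exists_dual_eq_one_card_mul_card_filter_le hv0 notMem_span
  have card_filter : (((T.erase v).erase 0).filter fun t => φ t = 0).card + 1 =
      (T.filter fun t => φ t = 0).card := by
    rw [Finset.filter_erase, Finset.filter_erase,
      Finset.erase_eq_of_notMem (a := v) (by simp [hφv]), Finset.card_erase_add_one (by simp [h0])]
  have card_erase : ((T.erase v).erase 0).card + 1 + 1 = T.card := by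
    rw [Finset.card_erase_add_one (Finset.mem_erase.2 ⟨hv0.symm, h0⟩),
      Finset.card_erase_add_one hv]
  rw [ZMod.card] at hφ
  exact ⟨φ, hφv, by lia⟩

theorem exists_linearMap_ne_zero_two_pow_mul_card_filter_le (h0 : 0 ∈ T) (hv : v ∈ T)
    (hv0 : v ≠ 0) (k : ℕ) : ∃ L : V →ₗ[ZMod 2] (Fin (k + 1) → ZMod 2), L v ≠ 0 ∧
      ((T.filter fun t => L t = 0) = {0} ∨
        2 ^ (k + 1) * (T.filter fun t => L t = 0).card ≤ T.card) := by
  induction k with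
  | zero =>
    obtain ⟨φ, hφv, hφ⟩ := exists_dual_eq_one_two_mul_card_filter_le h0 hv hv0
    refine ⟨LinearMap.pi fun _ => φ, ?_, Or.inr ?_⟩ <;> simp [funext_iff, hφv, hφ]
  | succ k ih =>
    obtain ⟨L, hLv, hL⟩ := ih
    have vecCons_eq_zero (φ : Dual (ZMod 2) V) (t : V) :
        φ.vecCons L t = 0 ↔ L t = 0 ∧ φ t = 0 := by
      rw [LinearMap.vecCons_apply, Matrix.cons_eq_zero_iff, and_comm]
    obtain hzero | ⟨w, hw, hw0⟩ : (T.filter fun t => L t = 0) = {0} ∨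
        ∃ w ∈ T.filter fun t => L t = 0, w ≠ 0 := by
      rw [or_iff_not_imp_right]
      push Not
      exact Finset.eq_singleton_iff_unique_mem.2 ∘ And.intro (by simp [h0])
    · refine ⟨LinearMap.vecCons 0 L, by simp [hLv], Or.inl ?_⟩
      simp only [vecCons_eq_zero, ← Finset.filter_filter, hzero]
      rfl
    · obtain ⟨φ, -, hφ⟩ := exists_dual_eq_one_two_mul_card_filter_le (by simp [h0]) hw hw0
      refine ⟨φ.vecCons L, by simp [hLv], Or.inr ?_⟩
      have hL' := hL.resolve_left fun h => hw0 (Finset.mem_singleton.1 (h ▸ hw))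
      simp only [vecCons_eq_zero, ← Finset.filter_filter]
      rw [pow_succ, mul_assoc]
      exact (Nat.mul_le_mul_left _ hφ).trans hL'

end BinaryFlats

namespace reedMuller

open MvPolynomial

variable {r m : ℕ} {α : Fin (2 ^ m) ≃ (Fin m → ZMod 2)} {c : Fin (2 ^ m) → ZMod 2}
  {σ : Equiv.Perm (Fin (2 ^ m))}

theorem two_pow_le_two_pow_mul_hammingNorm (hc : c ∈ reedMuller r m α) (hne : c ≠ 0) :
    2 ^ m ≤ 2 ^ r * hammingNorm c := by
  obtain ⟨f, hf, rfl⟩ := hc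
  obtain ⟨i, hi⟩ := Function.ne_iff.1 hne
  have norm_eq : hammingNorm (fun i => eval (α i) f) = hammingNorm (fun x => eval x f) :=
    Finset.card_equiv α (by simp)
  rw [norm_eq]
  simpa using card_le_two_pow_mul_hammingNorm_eval hf ⟨α i, hi⟩

theorem indicator_flat_mem (α : Fin (2 ^ m) ≃ (Fin m → ZMod 2))
    (L : (Fin m → ZMod 2) →ₗ[ZMod 2] (Fin r → ZMod 2)) (p : Fin m → ZMod 2) :
    (fun i => if L (α i - p) = 0 then 1 else 0) ∈ reedMuller r m α := by
  set ℓ : Fin r → MvPolynomial (Fin m) (ZMod 2) :=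
    fun k => (LinearMap.toMatrix' L).toMvPolynomial k + C (1 - L p k) with hℓ
  have totalDegree_ℓ (k) : (ℓ k).totalDegree ≤ 1 :=
    (totalDegree_add _ _).trans (max_le (Matrix.toMvPolynomial_totalDegree_le _ _)
      ((totalDegree_C _).trans_le zero_le_one))
  have add_one_eq_ite : ∀ y : ZMod 2, y + 1 = if y = 0 then 1 else 0 := by decide
  have eval_ℓ (x k) : eval x (ℓ k) = if L (x - p) k = 0 then 1 else 0 :=
    calc eval x (ℓ k) = L x k + (1 - L p k) := by
          simp [hℓ, Matrix.toMvPolynomial_eval_eq_apply]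
      _ = L (x - p) k + 1 := by rw [map_sub, Pi.sub_apply]; ring
      _ = _ := add_one_eq_ite _
  refine ⟨∏ k, ℓ k, (totalDegree_finsetProd _ _).trans ?_, ?_⟩
  · simpa using Finset.sum_le_sum fun k (_ : k ∈ Finset.univ) => totalDegree_ℓ k
  · funext i
    simp only [map_prod, eval_ℓ, Fintype.prod_ite_zero, Finset.prod_const_one, _root_.funext_iff,
      Pi.zero_apply]

theorem comp_eq_self_of_mem_codeAut (hσ : σ ∈ codeAut (reedMuller r m α))
    (hc : c ∈ reedMuller r m α)
    (hcard : 2 ^ (r + 1) * (σ.support.filter fun i => c i ≠ 0).card < 2 ^ m) : c ∘ σ = c := by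
  by_contra hne
  have hmem : -(c ∘ σ) + c ∈ reedMuller r m α := add_mem (neg_mem ((hσ c).2 hc)) hc
  refine hcard.not_ge ?_
  calc 2 ^ m ≤ 2 ^ r * hammingNorm (-(c ∘ σ) + c) :=
        two_pow_le_two_pow_mul_hammingNorm hmem (mt neg_add_eq_zero.1 hne)
    _ = 2 ^ r * hammingDist (c ∘ σ) c := by rw [hammingDist_eq_hammingNorm]
    _ ≤ 2 ^ r * (2 * (σ.support.filter fun i => c i ≠ 0).card) :=
        Nat.mul_le_mul_left _ (hammingDist_comp_perm_le σ c)
    _ = 2 ^ (r + 1) * (σ.support.filter fun i => c i ≠ 0).card := by rw [pow_succ, mul_assoc]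

theorem two_pow_le_two_mul_card_support (hr : 0 < r) (hrm : r + 2 ≤ m)
    (hσ : σ ∈ codeAut (reedMuller r m α)) (hne : σ ≠ 1) : 2 ^ m ≤ 2 * σ.support.card := by
  by_contra! hlt
  obtain ⟨p, hp⟩ : σ.support.Nonempty := by
    rwa [Finset.nonempty_iff_ne_empty, ne_eq, Equiv.Perm.support_eq_empty_iff]
  have hσp : σ p ∈ σ.support := Equiv.Perm.apply_mem_support.2 hp
  obtain ⟨k, rfl⟩ := Nat.exists_eq_add_of_le' hr
  set e : Fin (2 ^ m) ≃ (Fin m → ZMod 2) := α.trans (Equiv.subRight (α p))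
  have e_apply (i) : e i = α i - α p := rfl
  set T := σ.support.map e.toEmbedding with hT
  have e_mem {i} (hi : i ∈ σ.support) : e i ∈ T := Finset.mem_map_of_mem _ hi
  have e_p : e p = 0 := sub_self _
  have e_σp : e (σ p) ≠ 0 := e_p ▸ e.injective.ne (Equiv.Perm.mem_support.1 hp)
  obtain ⟨L, hLσp, hL⟩ :=
    exists_linearMap_ne_zero_two_pow_mul_card_filter_le (e_p ▸ e_mem hp) (e_mem hσp) e_σp k
  have card_flat : (σ.support.filter fun i => (if L (e i) = 0 then 1 else 0 : ZMod 2) ≠ 0).card =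
      (T.filter fun t => L t = 0).card := by
    simp [hT, Finset.filter_map]
  have few_moved : 2 ^ (k + 2) * (T.filter fun t => L t = 0).card < 2 ^ m := by
    obtain only_p | halved := hL
    · rw [only_p, Finset.card_singleton, mul_one]
      exact Nat.pow_lt_pow_right one_lt_two hrm
    · rw [hT, Finset.card_map] at halved
      rw [pow_succ']
      lia
  have invariant := comp_eq_self_of_mem_codeAut hσ (indicator_flat_mem α L (α p))
    (card_flat ▸ few_moved)
  exact hLσp (by simpa [e_apply] using congrFun invariant p)

theorem comp_linearMap_mem (L : (Fin m → ZMod 2) →ₗ[ZMod 2] (Fin m → ZMod 2))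
    (hc : c ∈ reedMuller r m α) : (fun i => c (α.symm (L (α i)))) ∈ reedMuller r m α := by
  obtain ⟨f, hf, rfl⟩ := hc
  refine ⟨bind₁ (LinearMap.toMatrix' L).toMvPolynomial f, ?_, ?_⟩
  · exact (totalDegree_bind₁_le (Matrix.toMvPolynomial_totalDegree_le _) f).trans hf
  · funext i
    simp [eval_bind₁, Matrix.toMvPolynomial_eval_eq_apply]

theorem permCongr_linearEquiv_mem_codeAut (r : ℕ) (α : Fin (2 ^ m) ≃ (Fin m → ZMod 2))
    (L : (Fin m → ZMod 2) ≃ₗ[ZMod 2] (Fin m → ZMod 2)) :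
    α.symm.permCongr L.toEquiv ∈ codeAut (reedMuller r m α) := by
  intro c
  refine ⟨fun h => ?_, comp_linearMap_mem L.toLinearMap⟩
  simpa using comp_linearMap_mem L.symm.toLinearMap h

theorem exists_mem_codeAut_two_mul_card_support_eq (r : ℕ) (hm : 2 ≤ m)
    (α : Fin (2 ^ m) ≃ (Fin m → ZMod 2)) :
    ∃ σ ∈ codeAut (reedMuller r m α), 2 * σ.support.card = 2 ^ m := by
  obtain ⟨n, rfl⟩ := Nat.exists_eq_add_of_le' hm
  set φ : Module.Dual (ZMod 2) (Fin (n + 2) → ZMod 2) := LinearMap.proj 0 with hφ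
  have hφv : φ (Pi.single 1 1) = 0 := by simp [hφ]
  set τ := LinearEquiv.transvection hφv
  refine ⟨α.symm.permCongr τ.toEquiv, permCongr_linearEquiv_mem_codeAut r α τ, ?_⟩
  have fixed_iff (x) : τ x = x ↔ φ x = 0 := by
    simp [τ, LinearMap.transvection.apply]
  have card_support : (α.symm.permCongr τ.toEquiv).support.card =
      (Finset.univ.filter fun x => ¬φ x = 0).card :=
    Finset.card_equiv α fun i => by simp [Equiv.symm_apply_eq, fixed_iff]
  have card_fixed : 2 * (Finset.univ.filter fun x => φ x = 0).card = 2 ^ (n + 2) := by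
    simpa using card_mul_card_filter_apply_eq_zero φ (w := Pi.single 0 1) (by simp [hφ])
      (s := Finset.univ) (by simp)
  have card_univ : (Finset.univ.filter fun x => φ x = 0).card +
      (Finset.univ.filter fun x => ¬φ x = 0).card = 2 ^ (n + 2) := by
    simpa using Finset.card_filter_add_card_filter_not (s := Finset.univ) (fun x => φ x = 0)
  lia

end reedMuller

theorem mainTheorem2 (r m : ℕ) (hr : 0 < r) (hrm : r < m) (h : r + 2 ≤ m ∨ m = 2)
    (α : Fin (2 ^ m) ≃ (Fin m → ZMod 2)) :
    IsMinimalDegree (codeAut (reedMuller r m α)) (2 ^ (m - 1)) ∧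
      (2 : ℚ) ^ (m - 1) = (2 ^ m : ℚ) / 2 := by
  obtain ⟨n, rfl⟩ := Nat.exists_eq_add_of_le' (show 1 ≤ m by lia)
  rw [Nat.add_sub_cancel]
  refine ⟨⟨?attained, ?lower_bound⟩, by rw [pow_succ]; ring⟩
  case attained =>
    obtain ⟨σ, hσ, hcard⟩ := reedMuller.exists_mem_codeAut_two_mul_card_support_eq r (by lia) α
    have card_support : σ.support.card = 2 ^ n := by lia
    refine ⟨σ, hσ, ?_, card_support⟩
    rintro rfl
    exact (Nat.two_pow_pos n).ne (by simpa using card_support)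
  case lower_bound =>
    rintro _ ⟨σ, hσ, hne, rfl⟩
    obtain h | h := h
    · have := reedMuller.two_pow_le_two_mul_card_support hr h hσ hne
      lia
    · obtain rfl : n = 1 := by lia
      exact Equiv.Perm.two_le_card_support_of_ne_one hne
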